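/- Let $q$ be a complex number with $|q|<1$. Then the double series (over all pairs of positive integers $m,n$) and the single series below converge absolutely, and $$\sum_{m,n\geq 1}\frac{(-q)^{2mn+m-1}}{(1+q^{2n-1})(1-q^{2m-1})}=\sum_{n\geq 1}\frac{q^{4n-2}}{(1-q^{4n-2})^2}.$$ In particular, the left-hand side is an even function of $q$ on the disc $|q|<1$. -/

import Mathlib

/-- The `(m, n)` term, `m, n ≥ 1`, of the double Lambert series
`∑ (-q)^(2mn+m-1) / ((1+q^(2n-1)) (1-q^(2m-1)))`. The exponents are natural numbers; the
subtractions do not truncate because `m, n ≥ 1`, and neither factor of the denominator vanishes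
when `‖q‖ < 1`. -/
noncomputable def doubleLambertTerm (q : ℂ) (m n : ℕ+) : ℂ :=
  (-q) ^ (2 * (m : ℕ) * (n : ℕ) + (m : ℕ) - 1) /
    ((1 + q ^ (2 * (n : ℕ) - 1)) * (1 - q ^ (2 * (m : ℕ) - 1)))

/-- The sum of the double Lambert series, over all pairs `(m, n)` of positive integers. -/
noncomputable def doubleLambertSeries (q : ℂ) : ℂ :=
  ∑' p : ℕ+ × ℕ+, doubleLambertTerm q p.1 p.2

/-! Let `T` be the sum of `kernel` over the open triangle `n < m`, `S` its sum over all pairs and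
`D` its diagonal sum. Expanding `1 / (1 - q^(2m-1))` geometrically and summing over `m` first turns
the double series into `T` (`tsum_natTerm`). Symmetry gives `S = D + 2T`. Summing `S` by
antidiagonals and `T` by offsets produces the same partial sums of `oddTerm` with opposite signs, so
`S + 2T` is a Lambert series `L` (`tsum_kernel_add_tsum_offset`). Hence `4T = L - D`, which is
evaluated termwise. -/

namespace DoubleLambert

/-- The symmetric kernel `q^(n+m+1) / ((1+q^(2n+1)) (1+q^(2m+1)))`. -/
noncomputable def kernel (q : ℂ) (n m : ℕ) : ℂ :=
  q ^ (n + m + 1) / ((1 + q ^ (2 * n + 1)) * (1 + q ^ (2 * m + 1)))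

lemma kernel_comm (q : ℂ) (n m : ℕ) : kernel q n m = kernel q m n := by
  simp only [kernel, add_comm n m, mul_comm (1 + q ^ (2 * n + 1))]

/-- The odd-index Lambert term `q^(2n+1) / (1+q^(2n+1))`. -/
noncomputable def oddTerm (q : ℂ) (n : ℕ) : ℂ :=
  q ^ (2 * n + 1) / (1 + q ^ (2 * n + 1))

/-! ### Nonvanishing denominators and geometric majorants. -/

section Bounds

variable {q : ℂ}

lemma norm_pow_succ_le (hq : ‖q‖ < 1) (n : ℕ) : ‖q ^ (n + 1)‖ ≤ ‖q‖ := by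
  rw [norm_pow]
  exact pow_le_of_le_one (norm_nonneg _) hq.le (Nat.succ_ne_zero n)

lemma norm_pow_succ_lt_one (hq : ‖q‖ < 1) (n : ℕ) : ‖q ^ (n + 1)‖ < 1 :=
  (norm_pow_succ_le hq n).trans_lt hq

lemma le_norm_one_sub (hq : ‖q‖ < 1) (n : ℕ) : 1 - ‖q‖ ≤ ‖1 - q ^ (n + 1)‖ := by
  have h := norm_sub_norm_le (1 : ℂ) (q ^ (n + 1))
  rw [norm_one] at h
  linarith [norm_pow_succ_le hq n]

lemma le_norm_one_add (hq : ‖q‖ < 1) (n : ℕ) : 1 - ‖q‖ ≤ ‖1 + q ^ (n + 1)‖ := by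
  have h := norm_sub_norm_le (1 : ℂ) (-q ^ (n + 1))
  rw [norm_one, norm_neg, sub_neg_eq_add] at h
  linarith [norm_pow_succ_le hq n]

lemma one_sub_pow_ne_zero (hq : ‖q‖ < 1) (n : ℕ) : 1 - q ^ (n + 1) ≠ 0 :=
  norm_pos_iff.mp ((sub_pos.mpr hq).trans_le (le_norm_one_sub hq n))

lemma one_add_pow_ne_zero (hq : ‖q‖ < 1) (n : ℕ) : 1 + q ^ (n + 1) ≠ 0 :=
  norm_pos_iff.mp ((sub_pos.mpr hq).trans_le (le_norm_one_add hq n))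

lemma norm_pow_le_of_le (hq : ‖q‖ < 1) {a b : ℕ} (h : b ≤ a) : ‖q‖ ^ a ≤ ‖q‖ ^ b :=
  pow_le_pow_of_le_one (norm_nonneg _) hq.le h

lemma summable_norm_pow (hq : ‖q‖ < 1) : Summable fun n : ℕ => ‖q‖ ^ n :=
  summable_geometric_of_lt_one (norm_nonneg _) hq

lemma summable_norm_pow_prod (hq : ‖q‖ < 1) :
    Summable fun p : ℕ × ℕ => ‖q‖ ^ p.1 * ‖q‖ ^ p.2 :=
  (summable_norm_pow hq).mul_of_nonneg (summable_norm_pow hq)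
    (fun _ => by positivity) (fun _ => by positivity)

lemma summable_norm_pow_triple (hq : ‖q‖ < 1) :
    Summable fun p : (ℕ × ℕ) × ℕ => ‖q‖ ^ p.1.1 * ‖q‖ ^ p.1.2 * ‖q‖ ^ p.2 :=
  (summable_norm_pow_prod hq).mul_of_nonneg (summable_norm_pow hq)
    (fun _ => by positivity) (fun _ => by positivity)

lemma norm_div_le_of_le {a b : ℂ} {A B : ℝ} (hB : 0 < B) (ha : ‖a‖ ≤ A) (hb : B ≤ ‖b‖) :
    ‖a / b‖ ≤ A / B := by
  rw [norm_div]
  exact div_le_div₀ ((norm_nonneg _).trans ha) ha hB hb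

lemma summable_kernel (hq : ‖q‖ < 1) : Summable fun p : ℕ × ℕ => kernel q p.1 p.2 := by
  have h0 : 0 < 1 - ‖q‖ := sub_pos.mpr hq
  refine .of_norm_bounded ((summable_norm_pow_prod hq).div_const ((1 - ‖q‖) * (1 - ‖q‖)))
    fun p => norm_div_le_of_le (by positivity) ?_ ?_
  · rw [norm_pow, ← pow_add]
    exact norm_pow_le_of_le hq (by omega)
  · rw [norm_mul]
    exact mul_le_mul (le_norm_one_add hq _) (le_norm_one_add hq _) h0.le (norm_nonneg _)

lemma summable_oddTerm (hq : ‖q‖ < 1) : Summable (oddTerm q) := by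
  refine .of_norm_bounded ((summable_norm_pow hq).div_const (1 - ‖q‖))
    fun n => norm_div_le_of_le (sub_pos.mpr hq) ?_ (le_norm_one_add hq _)
  rw [norm_pow]
  exact norm_pow_le_of_le hq (by omega)

lemma summable_norm_pow_div_one_sub_sq (hq : ‖q‖ < 1) (a b : ℕ) :
    Summable fun n : ℕ => ‖q ^ ((a + 1) * n + b + 1) / (1 - q ^ ((a + 1) * n + b + 1)) ^ 2‖ := by
  have h0 : 0 < 1 - ‖q‖ := sub_pos.mpr hq
  refine .of_nonneg_of_le (fun _ => norm_nonneg _)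
    (fun n => norm_div_le_of_le (A := ‖q‖ ^ n) (B := (1 - ‖q‖) ^ 2) (by positivity) ?_ ?_)
    ((summable_norm_pow hq).div_const _)
  · rw [norm_pow]
    exact norm_pow_le_of_le hq (by nlinarith)
  · rw [norm_pow]
    exact pow_le_pow_left₀ h0.le (le_norm_one_sub hq _) 2

end Bounds

/-! ### Symmetric double sums. -/

section Splitting

/-- `ℕ × ℕ` is the disjoint union of the diagonal and the two open triangles. -/
lemma bijective_triangles : Function.Bijective
    (Sum.elim (fun n : ℕ => (n, n)) (Sum.elim (fun p : ℕ × ℕ => (p.1, p.1 + p.2 + 1))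
      (fun p : ℕ × ℕ => (p.1 + p.2 + 1, p.1)))) := by
  constructor
  · rintro (a | a | a) (b | b | b) h <;>
      simp only [Sum.elim_inl, Sum.elim_inr, Sum.inl.injEq, Sum.inr.injEq,
        Prod.ext_iff, reduceCtorEq] at h ⊢ <;> omega
  · rintro ⟨a, b⟩
    rcases lt_trichotomy a b with h | h | h
    · exact ⟨.inr (.inl (a, b - a - 1)), by simp; omega⟩
    · exact ⟨.inl a, by simp [h]⟩
    · exact ⟨.inr (.inr (b, a - b - 1)), by simp; omega⟩

lemma tsum_symmetric {f : ℕ → ℕ → ℂ} (hs : ∀ n m, f n m = f m n)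
    (hf : Summable fun p : ℕ × ℕ => f p.1 p.2) :
    ∑' p : ℕ × ℕ, f p.1 p.2 =
      ∑' n, f n n + 2 * ∑' p : ℕ × ℕ, f p.1 (p.1 + p.2 + 1) := by
  let e := Equiv.ofBijective _ bijective_triangles
  have hinj := bijective_triangles.injective
  have h1 : Summable fun n : ℕ => f n n :=
    hf.comp_injective (i := fun n : ℕ => (n, n)) fun a b h => by simpa using h
  have h2 : Summable fun p : ℕ × ℕ => f p.1 (p.1 + p.2 + 1) :=
    hf.comp_injective (i := fun p : ℕ × ℕ => (p.1, p.1 + p.2 + 1))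
      (hinj.comp (Sum.inr_injective.comp Sum.inl_injective))
  have e3 : (fun p : ℕ × ℕ => f (p.1 + p.2 + 1) p.1) = fun p => f p.1 (p.1 + p.2 + 1) :=
    funext fun p => hs _ _
  have h3 : Summable fun p : ℕ × ℕ => f (p.1 + p.2 + 1) p.1 := e3 ▸ h2
  have h := h1.hasSum.sum (f := fun s => (fun p : ℕ × ℕ => f p.1 p.2) (e s))
    (h2.hasSum.sum (f := fun s => (fun p : ℕ × ℕ => f p.1 p.2) (e (.inr s))) h3.hasSum)
  rw [← e.tsum_eq, h.tsum_eq, e3]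
  ring

end Splitting

/-! ### Kernel sums along diagonals and antidiagonals. -/

section Diagonals

variable {q : ℂ}

/-- Partial fractions `a/(1+a) - b/(1+b) = (a-b)/((1+a)(1+b))`, where `b = a * q^(2k+2)`; the sum
over `n` then telescopes with step `k + 1`. -/
lemma kernel_offset (hq : ‖q‖ < 1) (n k : ℕ) :
    kernel q n (n + k + 1) = q ^ (k + 1) / (1 - q ^ (2 * k + 1 + 1)) *
      (oddTerm q n - oddTerm q (n + (k + 1))) := by
  have h1 := one_add_pow_ne_zero hq (2 * n)
  have h2 := one_add_pow_ne_zero hq (2 * (n + k + 1))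
  have h3 := one_sub_pow_ne_zero hq (2 * k + 1)
  simp only [kernel, oddTerm, ← add_assoc]
  field_simp
  ring

lemma tsum_kernel_offset (hq : ‖q‖ < 1) (k : ℕ) :
    ∑' n, kernel q n (n + k + 1) = q ^ (k + 1) / (1 - q ^ (2 * k + 1 + 1)) *
      ∑ j ∈ Finset.range (k + 1), oddTerm q j := by
  have hs := summable_oddTerm hq
  simp_rw [kernel_offset hq]
  rw [tsum_mul_left, hs.tsum_sub ((summable_nat_add_iff (k + 1)).mpr hs),
    ← hs.sum_add_tsum_nat_add (k + 1), add_sub_cancel_right]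

/-- With `a = q^(2i+1)` and `b = q^(2j+1)`, the bracket equals `(1-ab)/((1+a)(1+b))`, and `ab =
q^(2k+2)` depends only on `k`. -/
lemma kernel_antidiagonal (hq : ‖q‖ < 1) {i j k : ℕ} (h : i + j = k) :
    kernel q i j = q ^ (k + 1) / (1 - q ^ (2 * k + 1 + 1)) *
      (1 - oddTerm q i - oddTerm q j) := by
  subst h
  have h1 := one_add_pow_ne_zero hq (2 * i)
  have h2 := one_add_pow_ne_zero hq (2 * j)
  have h3 := one_sub_pow_ne_zero hq (2 * (i + j) + 1)
  simp only [kernel, oddTerm]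
  field_simp
  ring

lemma sum_kernel_antidiagonal (hq : ‖q‖ < 1) (k : ℕ) :
    ∑ p ∈ Finset.HasAntidiagonal.antidiagonal k, kernel q p.1 p.2 =
      q ^ (k + 1) / (1 - q ^ (2 * k + 1 + 1)) *
        ((k + 1) - 2 * ∑ j ∈ Finset.range (k + 1), oddTerm q j) := by
  rw [Finset.sum_congr rfl fun p hp => kernel_antidiagonal hq (Finset.HasAntidiagonal.mem_antidiagonal.mp hp),
    ← Finset.mul_sum, Finset.sum_sub_distrib, Finset.sum_sub_distrib,
    Finset.Nat.sum_antidiagonal_eq_sum_range_succ (fun i _ => oddTerm q i),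
    ← Finset.Nat.sum_antidiagonal_swap (f := fun p => oddTerm q p.2)]
  simp only [Prod.snd_swap]
  rw [Finset.Nat.sum_antidiagonal_eq_sum_range_succ (fun i _ => oddTerm q i)]
  simp only [Finset.sum_const, Finset.Nat.card_antidiagonal, nsmul_eq_mul, mul_one, Nat.cast_add,
    Nat.cast_one]
  ring

lemma tsum_kernel_add_tsum_offset (hq : ‖q‖ < 1) :
    ∑' p : ℕ × ℕ, kernel q p.1 p.2 + 2 * ∑' p : ℕ × ℕ, kernel q p.1 (p.1 + p.2 + 1) =
      ∑' k : ℕ, (k + 1) * (q ^ (k + 1) / (1 - q ^ (2 * k + 1 + 1))) := by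
  have hs := summable_kernel hq
  have ho : Summable fun p : ℕ × ℕ => kernel q p.1 (p.1 + p.2 + 1) :=
    hs.comp_injective (i := fun p : ℕ × ℕ => (p.1, p.1 + p.2 + 1))
      (bijective_triangles.injective.comp (Sum.inr_injective.comp Sum.inl_injective))
  have hsig := Finset.HasAntidiagonal.sigmaAntidiagonalEquivProd.summable_iff.mpr hs
  have ha : HasSum (fun k => ∑ p ∈ Finset.HasAntidiagonal.antidiagonal k, kernel q p.1 p.2)
      (∑' p : ℕ × ℕ, kernel q p.1 p.2) := by
    rw [← Finset.HasAntidiagonal.sigmaAntidiagonalEquivProd.tsum_eq]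
    convert! hsig.hasSum.sigma (fun k => (hsig.sigma_factor k).hasSum) using 1
    funext k
    rw [tsum_fintype, ← Finset.sum_coe_sort]
    rfl
  have hb : HasSum (fun k => ∑' n, kernel q n (n + k + 1))
      (∑' p : ℕ × ℕ, kernel q p.1 (p.1 + p.2 + 1)) := by
    have h := ho.prod_symm
    rw [← (Equiv.prodComm ℕ ℕ).tsum_eq]
    exact h.hasSum.prod_fiberwise fun k => (h.prod_factor k).hasSum
  rw [← (ha.add (hb.mul_left 2)).tsum_eq]
  refine tsum_congr fun k => ?_
  rw [sum_kernel_antidiagonal hq, tsum_kernel_offset hq]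
  ring

end Diagonals

/-! ### Evaluation of the Lambert series. -/

section Lambert

variable {q : ℂ}

lemma hasSum_succ_mul_pow_succ {x : ℂ} (hx : ‖x‖ < 1) :
    HasSum (fun k : ℕ => ((k : ℂ) + 1) * x ^ (k + 1)) (x / (1 - x) ^ 2) := by
  have h := (hasSum_nat_add_iff' (f := fun k : ℕ => (k : ℂ) * x ^ k) 1).mpr (hasSum_coe_mul_geometric_of_norm_lt_one hx)
  simpa using h

/-- Both sides are iterated sums of `(k+1) * q^((k+1)(2n+1))`, taken in opposite orders. -/
lemma tsum_lambert_eq (hq : ‖q‖ < 1) :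
    ∑' k : ℕ, (k + 1) * (q ^ (k + 1) / (1 - q ^ (2 * k + 1 + 1))) =
      ∑' n : ℕ, q ^ (2 * n + 1) / (1 - q ^ (2 * n + 1)) ^ 2 := by
  have hs : Summable (Function.uncurry fun k n : ℕ => ((k : ℂ) + 1) * q ^ ((k + 1) * (2 * n + 1))) := by
    have hk : Summable fun k : ℕ => ((k : ℝ) + 1) * ‖q‖ ^ k := by
      have h := summable_pow_mul_geometric_of_norm_lt_one 1 (r := ‖q‖) (by simpa using hq)
      simpa [add_mul] using h.add (summable_norm_pow hq)
    have hb : Summable fun p : ℕ × ℕ => ((p.1 : ℝ) + 1) * ‖q‖ ^ p.1 * ‖q‖ ^ p.2 :=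
      hk.mul_of_nonneg (summable_norm_pow hq) (fun _ => by positivity) (fun _ => by positivity)
    refine .of_norm_bounded hb fun p => ?_
    simp only [Function.uncurry, norm_mul, norm_pow]
    rw [mul_assoc, ← pow_add]
    refine mul_le_mul (by exact_mod_cast (Complex.norm_natCast (p.1 + 1)).le)
      (norm_pow_le_of_le hq (by nlinarith)) (by positivity) (by positivity)
  have h := hs.tsum_comm
  have h1 (k : ℕ) : ∑' n : ℕ, ((k : ℂ) + 1) * q ^ ((k + 1) * (2 * n + 1)) =
      (k + 1) * (q ^ (k + 1) / (1 - q ^ (2 * k + 1 + 1))) := by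
    rw [tsum_mul_left, div_eq_mul_inv, ← tsum_geometric_of_norm_lt_one
      (norm_pow_succ_lt_one hq (2 * k + 1))]
    congr 1
    rw [← tsum_mul_left]
    exact tsum_congr fun n => by ring
  have h2 (n : ℕ) : ∑' k : ℕ, ((k : ℂ) + 1) * q ^ ((k + 1) * (2 * n + 1)) =
      q ^ (2 * n + 1) / (1 - q ^ (2 * n + 1)) ^ 2 := by
    rw [← (hasSum_succ_mul_pow_succ (norm_pow_succ_lt_one hq (2 * n))).tsum_eq]
    refine tsum_congr fun k => ?_
    rw [← pow_mul, mul_comm (k + 1)]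
  simp_rw [h1, h2] at h
  exact h.symm

lemma tsum_kernel_offset_prod (hq : ‖q‖ < 1) :
    ∑' p : ℕ × ℕ, kernel q p.1 (p.1 + p.2 + 1) =
      ∑' n : ℕ, q ^ (4 * n + 2) / (1 - q ^ (4 * n + 2)) ^ 2 := by
  have h1 := tsum_kernel_add_tsum_offset hq
  rw [tsum_symmetric (kernel_comm q) (summable_kernel hq), tsum_lambert_eq hq] at h1
  have hd : Summable fun n => kernel q n n :=
    (summable_kernel hq).comp_injective (i := fun n : ℕ => (n, n)) fun a b h => by simpa using h
  have hl := (summable_norm_pow_div_one_sub_sq hq 1 0).of_norm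
  have h2 : ∑' n : ℕ, q ^ (2 * n + 1) / (1 - q ^ (2 * n + 1)) ^ 2 - ∑' n, kernel q n n =
      4 * ∑' n : ℕ, q ^ (4 * n + 2) / (1 - q ^ (4 * n + 2)) ^ 2 := by
    rw [← hl.tsum_sub hd, ← tsum_mul_left]
    -- For `x = q^(2n+1)`: `x/(1-x)^2 - x/(1+x)^2 = 4x^2/(1-x^2)^2`.
    refine tsum_congr fun n => ?_
    have e1 := one_add_pow_ne_zero hq (2 * n)
    have e2 := one_sub_pow_ne_zero hq (2 * n)
    have e3 : q ^ (4 * n + 2) = (q ^ (2 * n + 1)) ^ 2 := by ring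
    have e4 : q ^ (n + n + 1) = q ^ (2 * n + 1) := by ring
    simp only [kernel, e3, e4, one_add_one_eq_two, add_zero]
    generalize q ^ (2 * n + 1) = x at *
    have e5 : 1 - x ^ 2 = (1 - x) * (1 + x) := by ring
    rw [e5]
    field_simp
    ring
  linear_combination (1 / 4 : ℂ) * h1 + (1 / 4 : ℂ) * h2

end Lambert

/-! ### From the double series to the triangle sum. -/

section Expansion

variable {q : ℂ}

/-- The terms of the double Lambert series with indices starting at `0`. -/
noncomputable def natTerm (q : ℂ) (m n : ℕ) : ℂ :=
  (-q) ^ (m * (2 * n + 3) + 2 * n + 2) / ((1 + q ^ (2 * n + 1)) * (1 - q ^ (2 * m + 1)))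

lemma doubleLambertTerm_succPNat (q : ℂ) (m n : ℕ) :
    doubleLambertTerm q m.succPNat n.succPNat = natTerm q m n := by
  have e1 : 2 * (m + 1) * (n + 1) + (m + 1) - 1 = m * (2 * n + 3) + 2 * n + 2 := by
    rw [← add_assoc, Nat.add_sub_cancel]
    ring
  have e2 (n : ℕ) : 2 * (n + 1) - 1 = 2 * n + 1 := by omega
  simp only [doubleLambertTerm, natTerm, Nat.succPNat_coe, Nat.succ_eq_add_one, e1, e2]

lemma summable_norm_natTerm (hq : ‖q‖ < 1) :
    Summable fun p : ℕ × ℕ => ‖natTerm q p.1 p.2‖ := by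
  have h0 : 0 < 1 - ‖q‖ := sub_pos.mpr hq
  refine .of_nonneg_of_le (fun _ => norm_nonneg _)
    (fun p => norm_div_le_of_le (A := ‖q‖ ^ p.1 * ‖q‖ ^ p.2) (B := (1 - ‖q‖) * (1 - ‖q‖))
      (by positivity) ?_ ?_) ((summable_norm_pow_prod hq).div_const _)
  · rw [norm_pow, norm_neg, ← pow_add]
    exact norm_pow_le_of_le hq (by nlinarith)
  · rw [norm_mul]
    exact mul_le_mul (le_norm_one_add hq _) (le_norm_one_sub hq _) h0.le (norm_nonneg _)

/-- The terms of the triple series refining both the double Lambert series and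
`∑ kernel q n (n + k + 1)`. -/
noncomputable def tripleTerm (q : ℂ) (m n k : ℕ) : ℂ :=
  (-q) ^ (m * (2 * n + 3) + 2 * n + 2) * q ^ ((2 * m + 1) * k) / (1 + q ^ (2 * n + 1))

lemma summable_tripleTerm (hq : ‖q‖ < 1) :
    Summable fun p : (ℕ × ℕ) × ℕ => tripleTerm q p.1.1 p.1.2 p.2 := by
  refine .of_norm_bounded ((summable_norm_pow_triple hq).div_const (1 - ‖q‖))
    fun p => norm_div_le_of_le (sub_pos.mpr hq) ?_ (le_norm_one_add hq _)
  rw [norm_mul, norm_pow, norm_pow, norm_neg, ← pow_add, ← pow_add, ← pow_add]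
  exact norm_pow_le_of_le hq (by nlinarith [Nat.zero_le (p.1.1 * p.1.2), Nat.zero_le (p.1.1 * p.2)])

lemma tsum_tripleTerm_right (hq : ‖q‖ < 1) (m n : ℕ) :
    ∑' k, tripleTerm q m n k = natTerm q m n := by
  have h := tsum_geometric_of_norm_lt_one (norm_pow_succ_lt_one hq (2 * m))
  simp only [tripleTerm, natTerm, pow_mul q (2 * m + 1), mul_div_right_comm _ (_ ^ _)]
  rw [tsum_mul_left, h, ← div_div, div_eq_mul_inv _ (1 - _)]

lemma tsum_tripleTerm_left (hq : ‖q‖ < 1) (n k : ℕ) :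
    ∑' m, tripleTerm q m n k = kernel q n (n + k + 1) := by
  have e (m : ℕ) : tripleTerm q m n k =
      q ^ (2 * n + k + 2) / (1 + q ^ (2 * n + 1)) * (-q ^ (2 * (n + k + 1) + 1)) ^ m := by
    -- The exponent has the parity of `m`, so the sign is `(-1)^m` and the series in `m` is
    -- geometric with ratio `-q^(2(n+k+1)+1)`.
    have h1 : (-q) ^ (m * (2 * n + 3) + 2 * n + 2) =
        (-1) ^ m * q ^ (m * (2 * n + 3) + 2 * n + 2) := by
      rw [neg_pow]
      congr 1
      rw [show m * (2 * n + 3) + 2 * n + 2 = 2 * (m * n + m + n + 1) + m by ring, pow_add, pow_mul]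
      simp
    rw [tripleTerm, h1, neg_pow (q ^ _)]
    ring
  simp_rw [e]
  rw [tsum_mul_left, tsum_geometric_of_norm_lt_one
    (by rw [norm_neg]; exact norm_pow_succ_lt_one hq _), kernel, sub_neg_eq_add, ← div_div,
    div_eq_mul_inv _ (1 + q ^ (2 * (n + k + 1) + 1))]
  congr 3
  ring

lemma tsum_natTerm (hq : ‖q‖ < 1) :
    ∑' p : ℕ × ℕ, natTerm q p.1 p.2 = ∑' p : ℕ × ℕ, kernel q p.1 (p.1 + p.2 + 1) := by
  have hs := summable_tripleTerm hq
  have hs' : Summable fun p : ℕ × (ℕ × ℕ) => tripleTerm q p.1 p.2.1 p.2.2 :=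
    (Equiv.prodAssoc ℕ ℕ ℕ).symm.summable_iff.mpr hs
  simp_rw [← tsum_tripleTerm_right hq, ← tsum_tripleTerm_left hq]
  rw [← hs.tsum_prod, ← (Equiv.prodAssoc ℕ ℕ ℕ).symm.tsum_eq]
  exact hs'.tsum_prod.trans
    (Summable.tsum_comm (f := fun m (p : ℕ × ℕ) => tripleTerm q m p.1 p.2) hs').symm

end Expansion

/-- Shifting both indices identifies pairs of natural numbers with pairs of positive integers. -/
def natProdEquivPNatProd : ℕ × ℕ ≃ ℕ+ × ℕ+ :=
  Equiv.prodCongr Equiv.pnatEquivNat.symm Equiv.pnatEquivNat.symm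

lemma natProdEquivPNatProd_apply (p : ℕ × ℕ) :
    natProdEquivPNatProd p = (p.1.succPNat, p.2.succPNat) := rfl

lemma four_mul_succPNat_sub (n : ℕ) : 4 * (n.succPNat : ℕ) - 2 = 4 * n + 2 := by
  rw [Nat.succPNat_coe]
  omega

lemma summable_norm_doubleLambertTerm {q : ℂ} (hq : ‖q‖ < 1) :
    Summable fun p : ℕ+ × ℕ+ => ‖doubleLambertTerm q p.1 p.2‖ := by
  refine natProdEquivPNatProd.summable_iff.mp ((summable_norm_natTerm hq).congr fun p => ?_)
  rw [Function.comp_apply, natProdEquivPNatProd_apply, doubleLambertTerm_succPNat]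

lemma doubleLambertSeries_eq {q : ℂ} (hq : ‖q‖ < 1) :
    doubleLambertSeries q =
      ∑' n : ℕ+, q ^ (4 * (n : ℕ) - 2) / (1 - q ^ (4 * (n : ℕ) - 2)) ^ 2 := by
  rw [doubleLambertSeries, ← natProdEquivPNatProd.tsum_eq, ← Equiv.pnatEquivNat.symm.tsum_eq]
  simp_rw [natProdEquivPNatProd_apply, doubleLambertTerm_succPNat]
  rw [tsum_natTerm hq, tsum_kernel_offset_prod hq]
  refine tsum_congr fun n => ?_
  rw [Equiv.pnatEquivNat_symm_apply, four_mul_succPNat_sub]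

end DoubleLambert

open DoubleLambert in
theorem theorem5p7 (q : ℂ) (hq : ‖q‖ < 1) :
    (Summable fun p : ℕ+ × ℕ+ => ‖doubleLambertTerm q p.1 p.2‖) ∧
    (Summable fun n : ℕ+ => ‖q ^ (4 * (n : ℕ) - 2) / (1 - q ^ (4 * (n : ℕ) - 2)) ^ 2‖) ∧
    doubleLambertSeries q =
      ∑' n : ℕ+, q ^ (4 * (n : ℕ) - 2) / (1 - q ^ (4 * (n : ℕ) - 2)) ^ 2 ∧
    doubleLambertSeries (-q) = doubleLambertSeries q := by
  refine ⟨summable_norm_doubleLambertTerm hq, ?_, doubleLambertSeries_eq hq, ?_⟩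
  · refine Equiv.pnatEquivNat.symm.summable_iff.mp
      ((summable_norm_pow_div_one_sub_sq hq 3 1).congr fun n => ?_)
    rw [Function.comp_apply, Equiv.pnatEquivNat_symm_apply, four_mul_succPNat_sub]
  -- Evenness is read off the single series, where only even powers of `q` occur.
  · rw [doubleLambertSeries_eq hq, doubleLambertSeries_eq (by rwa [norm_neg])]
    refine tsum_congr fun n => ?_
    rw [Even.neg_pow ⟨2 * (n : ℕ) - 1, by omega⟩]
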